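/- All graphs are finite and simple. The treedepth $\mathrm{td}(G)$ of a graph $G$ is the minimum integer $d$ for which there exists a rooted forest of depth at most $d-1$ with vertex set $V(G)$ (roots having depth $0$) such that every edge of $G$ joins a vertex to one of its ancestors or descendants in the forest. For a non-decreasing function $r\colon\mathbb{N}\to\mathbb{R}_{\ge 0}$, a graph $G$ is fractionally $\mathrm{td}$-fragile at rate $r$ if for every positive integer $a$ there exists a probability distribution on the sets $Y\subseteq V(G)$ satisfying $\mathrm{td}(G-Y)\le r(a)$ such that each vertex of $G$ belongs to a random set sampled from this distribution with probability at most $1/a$. Theorem. Let $r\colon\mathbb{N}\to\mathbb{R}_{\ge 0}$ be a non-decreasing function. If all planar graphs of treewidth at most two are fractionally $\mathrm{td}$-fragile at rate $r$, then $r(a)=\Omega(a^2)$; that is, there exist $c>0$ and $a_0$ such that $r(a)\ge c\,a^2$ for all integers $a\ge a_0$. -/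

import Mathlib

open scoped NNReal ENNReal

namespace Fragility

/-! ### Planarity -/

/-- `G` is planar: it can be drawn in the plane, the vertices being distinct points and each edge `e`
a simple arc `arc e` between its ends, so that an arc contains no vertex other than the ends of its
edge, and two distinct arcs meet only in common ends of their edges. -/
def IsPlanar {V : Type*} (G : SimpleGraph V) : Prop :=
  ∃ (pos : V → ℝ × ℝ) (arc : Sym2 V → Set (ℝ × ℝ)),
    Function.Injective pos ∧
    (∀ u v, G.Adj u v → ∃ γ : unitInterval → ℝ × ℝ,
      Continuous γ ∧ Function.Injective γ ∧ γ 0 = pos u ∧ γ 1 = pos v ∧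
        Set.range γ = arc s(u, v)) ∧
    (∀ e ∈ G.edgeSet, ∀ w, pos w ∈ arc e → w ∈ e) ∧
    (∀ e ∈ G.edgeSet, ∀ f ∈ G.edgeSet, e ≠ f → arc e ∩ arc f ⊆ pos '' {w | w ∈ e ∧ w ∈ f})

/-! ### Treewidth -/

/-- A tree decomposition of `G`, with a finite tree. -/
structure TreeDecomposition {V : Type*} (G : SimpleGraph V) where
  /-- the nodes of the tree -/
  Node : Type
  finite_node : Finite Node
  tree : SimpleGraph Node
  isTree : tree.IsTree
  bag : Node → Finset V
  exists_mem_bag : ∀ v, ∃ i, v ∈ bag i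
  exists_edge_bag : ∀ u v, G.Adj u v → ∃ i, u ∈ bag i ∧ v ∈ bag i
  /-- the nodes whose bags contain a given vertex induce a connected subgraph of the tree -/
  connected_bags : ∀ v, (tree.induce {i | v ∈ bag i}).Connected

/-- The treewidth of a finite graph: the least `k` such that some tree decomposition has all its
bags of size at most `k + 1`. -/
noncomputable def treewidth {V : Type*} (G : SimpleGraph V) : ℕ :=
  sInf {k : ℕ | ∃ D : TreeDecomposition G, ∀ i, (D.bag i).card ≤ k + 1}

/-! ### Treedepth -/

/-- A rooted forest with vertex set `V`: the roots are the vertices without parent, and `depth v`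
is the distance of `v` from the root of its component. -/
structure RootedForest (V : Type*) where
  parent : V → Option V
  depth : V → ℕ
  depth_root : ∀ v, parent v = none → depth v = 0
  depth_child : ∀ v p, parent v = some p → depth v = depth p + 1

/-- `u` is an ancestor of `v` (every vertex being an ancestor of itself). -/
def RootedForest.IsAncestor {V : Type*} (F : RootedForest V) (u v : V) : Prop :=
  Relation.ReflTransGen (fun x y => F.parent y = some x) u v

/-- The treedepth of a finite graph: the least `d` for which there is a rooted forest on the vertices
of `G`, of depth at most `d - 1`, such that every edge of `G` joins a vertex to one of its ancestors
or descendants. -/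
noncomputable def treedepth {V : Type*} (G : SimpleGraph V) : ℕ :=
  sInf {d : ℕ | ∃ F : RootedForest V, (∀ v, F.depth v < d) ∧
    ∀ u v, G.Adj u v → F.IsAncestor u v ∨ F.IsAncestor v u}

/-! ### Fractional fragility -/

/-- The sets `Y` of vertices of `G` such that `f (G - Y) ≤ b`. -/
def destroyers (f : ∀ W : Type, SimpleGraph W → ℝ) {V : Type} (G : SimpleGraph V) (b : ℝ) :
    Set (Set V) :=
  {Y | f _ (G.induce Yᶜ) ≤ b}

/-- A probability distribution on sets of vertices is `ε`-thin if each vertex belongs to a random set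
with probability at most `ε`. -/
def IsThin {V : Type*} (ε : ℝ) (p : PMF (Set V)) : Prop :=
  ∀ v, p.toOuterMeasure {X | v ∈ X} ≤ ENNReal.ofReal ε

/-- `G` is fractionally `f`-fragile at rate `r`. -/
def FractionallyFragile (f : ∀ W : Type, SimpleGraph W → ℝ) (r : ℕ → ℝ≥0) {V : Type}
    (G : SimpleGraph V) : Prop :=
  ∀ a : ℕ, 0 < a → ∃ p : PMF (Set V), p.support ⊆ destroyers f G (r a) ∧ IsThin (1 / (a : ℝ)) p

/-- The graph parameter `td`. -/
noncomputable def td (W : Type) (G : SimpleGraph W) : ℝ := treedepth G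

end Fragility

namespace Fragility

/-! ### Two-page book embeddings -/

/-! The extremal graph is a complete tree of depth `m * m` with very large branching, plus skip
edges between consecutive levels that are multiples of `m`. It is planar (`Word.isPlanar_skipTree`)
and has treewidth at most 2 (`Word.treewidth_skipTree_le`). Take `a ≥ 16 * m`, and give every
position of a branch weight 1, with an extra `m` at multiples of `m`. The total is at most `4 * m ^
2` per branch, so by averaging (`IsThin.exists_sum_le`) some admissible `Y` has average weight at
most `m / 4` per branch. Fix an elimination forest of what remains. With large branching, few
branches have a lower end of an edge as forest ancestor of its upper end
(`Word.card_branches_mul_le`). On any other branch that keeps its multiples of `m`, skip edges make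
the forest depth increase across damaged segments, and each intact segment adds `m`
(`mul_le_add_mul_sum`). Averaged over branches, the forest depth is at least a constant times `m ^
2`, with `m` of order `a`. -/

/-- If the vertices of a finite graph are linearly ordered and its edges are distributed onto two
pages so that no two edges of the same page cross, then the graph is planar. -/
theorem isPlanar_of_twoPage {V : Type*} [Finite V] [LinearOrder V] (G : SimpleGraph V)
    (U : Set (Sym2 V))
    (hU : ∀ x y w z, x < y → y < w → w < z → G.Adj x w → G.Adj y z →
      ¬ (s(x, w) ∈ U ↔ s(y, z) ∈ U)) : IsPlanar G := by
  classical
  obtain ⟨t, ht⟩ : ∃ t : V → ℝ, StrictMono t := by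
    have := Fintype.ofFinite V
    refine ⟨fun v => ((Finset.univ.filter (· < v)).card : ℝ), fun v w h => ?_⟩
    refine Nat.cast_lt.2 (Finset.card_lt_card ?_)
    rw [Finset.ssubset_iff_of_subset fun x hx => by
      simp only [Finset.mem_filter, Finset.mem_univ, true_and] at hx ⊢
      exact hx.trans h]
    exact ⟨v, by simpa using h, by simp⟩
  set σ : Sym2 V → ℝ := fun e => if e ∈ U then 1 else -1 with hσ
  have hσ0 : ∀ e, σ e = 1 ∨ σ e = -1 := fun e => by simp only [hσ]; split_ifs <;> simp
  -- Each edge is a parabola over the interval between its ends, above or below the axis according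
  -- to its page.
  set arc : Sym2 V → Set (ℝ × ℝ) := fun e => {q | ∃ u v, u < v ∧ e = s(u, v) ∧ t u ≤ q.1 ∧
    q.1 ≤ t v ∧ q.2 = σ e * ((q.1 - t u) * (t v - q.1))} with harc
  have mem_arc : ∀ u v, u < v → ∀ q ∈ arc s(u, v), t u ≤ q.1 ∧ q.1 ≤ t v ∧
      q.2 = σ s(u, v) * ((q.1 - t u) * (t v - q.1)) := by
    rintro u v huv q ⟨u', v', huv', he, h⟩
    rw [Sym2.eq_iff] at he
    rcases he with ⟨rfl, rfl⟩ | ⟨rfl, rfl⟩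
    · exact h
    · exact absurd huv huv'.asymm
  have edge_ind : ∀ P : Sym2 V → Prop, (∀ u v, u < v → G.Adj u v → P s(u, v)) →
      ∀ e ∈ G.edgeSet, P e := by
    intro P hP e
    induction e using Sym2.ind with
    | _ u v =>
      intro he
      rcases lt_or_gt_of_ne (G.ne_of_adj he) with h | h
      · exact hP u v h he
      · rw [Sym2.eq_swap]; exact hP v u h (G.adj_symm he)
  have hpath : ∀ u v, u < v → ∃ γ : unitInterval → ℝ × ℝ,
      Continuous γ ∧ Function.Injective γ ∧ γ 0 = (t u, 0) ∧ γ 1 = (t v, 0) ∧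
        Set.range γ = arc s(u, v) := by
    intro u v huv
    have h := ht huv
    refine ⟨fun s => (t u + s * (t v - t u), σ s(u, v) * ((s * (t v - t u)) *
      ((1 - s) * (t v - t u)))), by fun_prop, ?_, by simp, by simp, ?_⟩
    · intro s s' hs
      have h1 := (Prod.ext_iff.1 hs).1
      have h2 : (s : ℝ) * (t v - t u) = s' * (t v - t u) := by simpa using h1
      exact Subtype.ext (mul_right_cancel₀ (sub_pos.2 h).ne' h2)
    · ext q
      constructor
      · rintro ⟨s, rfl⟩
        have := s.2.1
        have := s.2.2
        refine ⟨u, v, huv, rfl, ?_, ?_, ?_⟩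
        · dsimp only; nlinarith
        · dsimp only; nlinarith
        · dsimp only; ring
      · intro hq
        obtain ⟨h1, h2, h3⟩ := mem_arc u v huv q hq
        have hd := sub_pos.2 h
        refine ⟨⟨(q.1 - t u) / (t v - t u), div_nonneg (by linarith) hd.le,
          (div_le_one hd).2 (by linarith)⟩, Prod.ext ?_ ?_⟩
        · dsimp only; rw [div_mul_cancel₀ _ hd.ne']; ring
        · dsimp only; rw [h3, sub_mul, div_mul_cancel₀ _ hd.ne']; ring
  have hzero : ∀ u v, u < v → ∀ q ∈ arc s(u, v), q.2 = 0 → q = (t u, 0) ∨ q = (t v, 0) := by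
    intro u v huv q hq h0
    obtain ⟨h1, h2, h3⟩ := mem_arc u v huv q hq
    rw [h0] at h3
    have hs : σ s(u, v) ≠ 0 := by rcases hσ0 s(u, v) with h | h <;> rw [h] <;> norm_num
    rcases mul_eq_zero.1 ((mul_eq_zero.1 h3.symm).resolve_left hs) with h | h
    · exact Or.inl (Prod.ext (by dsimp only; linarith) h0)
    · exact Or.inr (Prod.ext (by dsimp only; linarith) h0)
  have hpos : Function.Injective fun v => (t v, (0 : ℝ)) := fun v w h =>
    ht.injective (Prod.ext_iff.1 h).1
  have hend : ∀ e ∈ G.edgeSet, ∀ q ∈ arc e, q.2 = 0 → ∃ w ∈ e, q = (t w, 0) := by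
    refine edge_ind _ fun u v huv _ q hq h0 => ?_
    rcases hzero u v huv q hq h0 with h | h
    · exact ⟨u, by simp, h⟩
    · exact ⟨v, by simp, h⟩
  refine ⟨fun v => (t v, 0), arc, hpos, ?_, ?_, ?_⟩
  · intro u v huv
    rcases lt_or_gt_of_ne (G.ne_of_adj huv) with h | h
    · exact hpath u v h
    · obtain ⟨γ, h1, h2, h3, h4, h5⟩ := hpath v u h
      refine ⟨γ ∘ unitInterval.symm, h1.comp unitInterval.continuous_symm,
        h2.comp unitInterval.symm_bijective.1, by simp [h4], by simp [h3], ?_⟩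
      rw [unitInterval.symm_bijective.2.range_comp, h5, Sym2.eq_swap]
  · intro e he w hw
    obtain ⟨w', hw', h⟩ := hend e he _ hw rfl
    exact hpos h ▸ hw'
  · -- it suffices to show that a common point lies on the axis
    suffices key : ∀ e ∈ G.edgeSet, ∀ f ∈ G.edgeSet, e ≠ f → ∀ q ∈ arc e, q ∈ arc f → q.2 = 0 by
      rintro e he f hf hef q ⟨hqe, hqf⟩
      have h0 := key e he f hf hef q hqe hqf
      obtain ⟨w, hw, rfl⟩ := hend e he q hqe h0
      obtain ⟨w', hw', h⟩ := hend f hf _ hqf h0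
      exact ⟨w, ⟨hw, hpos h ▸ hw'⟩, rfl⟩
    refine edge_ind _ fun x w hxw hadj => edge_ind _ fun y z hyz hadj' hne q hq hq' => ?_
    -- On one page the intervals are disjoint up to an end, or nested. When nested, both factors of
    -- the outer product dominate those of the inner one, so equality forces a point of the axis.
    have main : ∀ x w y z, x < w → y < z → G.Adj x w → G.Adj y z → s(x, w) ≠ s(y, z) →
        q ∈ arc s(x, w) → q ∈ arc s(y, z) → σ s(x, w) = σ s(y, z) → x ≤ y →
        (q.1 - t x) * (t w - q.1) = 0 := by
      intro x w y z hxw hyz hadj hadj' hne hq hq' hs hxy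
      obtain ⟨h1, h2, h3⟩ := mem_arc x w hxw q hq
      obtain ⟨h1', h2', h3'⟩ := mem_arc y z hyz q hq'
      have heq : (q.1 - t x) * (t w - q.1) = (q.1 - t y) * (t z - q.1) := by
        have : σ s(x, w) ≠ 0 := by rcases hσ0 s(x, w) with h | h <;> rw [h] <;> norm_num
        refine mul_left_cancel₀ this ?_
        rw [← h3, h3', hs]
      have hU' : s(x, w) ∈ U ↔ s(y, z) ∈ U := by
        simp only [hσ] at hs
        split_ifs at hs with h h' h' <;> first | exact iff_of_true h h' | exact iff_of_false h h' |
          norm_num at hs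
      rcases le_or_gt w y with hwy | hyw
      · have : q.1 = t w := le_antisymm h2 ((ht.monotone hwy).trans h1')
        rw [this]; ring
      have hxy' := ht.monotone hxy
      rcases le_or_gt z w with hzw | hwz
      · have hzw' := ht.monotone hzw
        rcases hxy.lt_or_eq with hlt | rfl
        · have hlt' := ht hlt
          have : (t w - q.1) = 0 := by nlinarith
          rw [this, mul_zero]
        · rcases hzw.lt_or_eq with hlt | rfl
          · have hlt' := ht hlt
            have : (q.1 - t x) = 0 := by nlinarith
            rw [this, zero_mul]
          · exact absurd rfl hne
      · rcases hxy.lt_or_eq with hlt | rfl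
        · exact absurd hU' (hU x y w z hlt hyw hwz hadj hadj')
        · have hlt' := ht hwz
          have : (q.1 - t x) = 0 := by nlinarith
          rw [this, zero_mul]
    have h3 := (mem_arc x w hxw q hq).2.2
    have h3' := (mem_arc y z hyz q hq').2.2
    by_cases hs : σ s(x, w) = σ s(y, z)
    · rcases le_total x y with hxy | hxy
      · rw [h3, main x w y z hxw hyz hadj hadj' hne hq hq' hs hxy, mul_zero]
      · rw [h3', main y z x w hyz hxw hadj' hadj hne.symm hq' hq hs.symm hxy, mul_zero]
    · have p : 0 ≤ (q.1 - t x) * (t w - q.1) := by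
        obtain ⟨h1, h2, -⟩ := mem_arc x w hxw q hq
        exact mul_nonneg (by linarith) (by linarith)
      have p' : 0 ≤ (q.1 - t y) * (t z - q.1) := by
        obtain ⟨h1, h2, -⟩ := mem_arc y z hyz q hq'
        exact mul_nonneg (by linarith) (by linarith)
      rcases hσ0 s(x, w) with h | h <;> rcases hσ0 s(y, z) with h' | h' <;>
        rw [h] at h3 <;> rw [h'] at h3'
      · exact absurd (h.trans h'.symm) hs
      · linarith
      · linarith
      · exact absurd (h.trans h'.symm) hs

/-! ### Lexicographic order and prefixes -/

theorem cons_le_cons_iff_lex {α : Type*} [LinearOrder α] {a b : α} {l l' : List α} :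
    a :: l ≤ b :: l' ↔ a < b ∨ a = b ∧ l ≤ l' := by
  have key : ∀ {a b : α} {l l' : List α}, a :: l < b :: l' ↔ a < b ∨ a = b ∧ l < l' := by
    intro a b l l'
    constructor
    · rintro (h | h | h)
      · exact Or.inl h
      · exact Or.inr ⟨rfl, h⟩
    · rintro (h | ⟨rfl, h⟩)
      · exact .rel h
      · exact .cons h
  rw [le_iff_lt_or_eq, key, le_iff_lt_or_eq, List.cons.injEq]
  tauto

theorem nil_le_of_lex {α : Type*} [LinearOrder α] (l : List α) : [] ≤ l := by
  cases l with
  | nil => exact le_rfl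
  | cons a l => exact le_of_lt (show [] < a :: l from .nil)

/-- Lexicographic order is the preorder of the tree of words, so the descendants of a vertex form an
interval starting at that vertex. -/
theorem prefix_of_le_of_le {α : Type*} [LinearOrder α] {p y z : List α} (hpz : p <+: z)
    (hpy : p ≤ y) (hyz : y ≤ z) : p <+: y := by
  induction p generalizing y z with
  | nil => exact List.nil_prefix
  | cons c p ih =>
    obtain ⟨s, rfl⟩ := hpz
    cases y with
    | nil => exact absurd (show [] < c :: p from .nil) (not_lt_of_ge hpy)
    | cons e y =>
      rw [List.cons_append, cons_le_cons_iff_lex] at hyz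
      rw [cons_le_cons_iff_lex] at hpy
      have hce : c = e := by
        rcases hpy with h | h <;> rcases hyz with h' | h'
        · exact absurd h h'.asymm
        · exact h'.1.symm
        · exact h.1
        · exact h.1
      subst hce
      have h1 : p ≤ y := by simpa using hpy
      have h2 : y ≤ p ++ s := by simpa using hyz
      exact (List.prefix_cons_inj c).2 (ih (List.prefix_append p s) h1 h2)

theorem le_of_prefix {α : Type*} [LinearOrder α] {p x : List α} (h : p <+: x) : p ≤ x := by
  induction p generalizing x with
  | nil => exact nil_le_of_lex x
  | cons c p ih =>
    obtain ⟨s, rfl⟩ := h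
    rw [List.cons_append, cons_le_cons_iff_lex]
    exact Or.inr ⟨rfl, ih (List.prefix_append p s)⟩

/-! ### Trees with skips -/

/-- The vertices of the complete rooted tree of depth `n` whose branching is given by `α`: words of
length at most `n`, the parent of a word being obtained by deleting its last letter. -/
abbrev Word (α : Type) (n : ℕ) : Type := {l : List α // l.length ≤ n}

instance (α : Type) [Finite α] (n : ℕ) : Finite (Word α n) :=
  (List.finite_length_le α n).to_subtype

namespace Word

variable {α : Type} {n : ℕ}

/-- The ancestor of `v` at depth `k` (or `v` itself, if its depth is less than `k`). -/
def take (k : ℕ) (v : Word α n) : Word α n := ⟨v.1.take k, (List.length_take_le' k v.1).trans v.2⟩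

/-- The complete rooted tree. -/
def tree (α : Type) (n : ℕ) : SimpleGraph (Word α n) :=
  SimpleGraph.fromRel fun x w => x.1 <+: w.1 ∧ w.1.length = x.1.length + 1

/-- The complete rooted tree, where in addition each vertex whose depth is a multiple of `D` is
adjacent to its descendants `D` levels below. -/
def skipTree (α : Type) (n D : ℕ) : SimpleGraph (Word α n) :=
  SimpleGraph.fromRel fun x w => x.1 <+: w.1 ∧
    (w.1.length = x.1.length + 1 ∨ D ∣ x.1.length ∧ w.1.length = x.1.length + D)

/-- In preorder, tree edges go on one page and longer edges on the other. If `x w` and `y z` cross,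
then `x`, `y`, `w` are strictly nested prefixes, so `x w` is not a tree edge. If `y z` were a skip
too, the depth of `y` would be a multiple of `D` strictly between two consecutive ones. -/
theorem isPlanar_skipTree (α : Type) [Finite α] [LinearOrder α] (n D : ℕ) :
    IsPlanar (skipTree α n D) := by
  have key : ∀ x w : Word α n, x < w → (skipTree α n D).Adj x w → x.1 <+: w.1 ∧
      (w.1.length = x.1.length + 1 ∨ D ∣ x.1.length ∧ w.1.length = x.1.length + D) := by
    intro x w hxw hadj
    rw [skipTree, SimpleGraph.fromRel_adj] at hadj
    refine hadj.2.resolve_right fun h => ?_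
    exact absurd hxw (not_lt_of_ge (le_of_prefix h.1))
  have mem : ∀ x w : Word α n, x.1 <+: w.1 →
      (s(x, w) ∈ {e : Sym2 (Word α n) | ∃ x w, e = s(x, w) ∧ w.1.length = x.1.length + 1} ↔
        w.1.length = x.1.length + 1) := by
    intro x w h
    refine ⟨?_, fun h' => ⟨x, w, rfl, h'⟩⟩
    rintro ⟨x', w', he, h'⟩
    have hl := h.length_le
    rw [Sym2.eq_iff] at he
    rcases he with ⟨rfl, rfl⟩ | ⟨rfl, rfl⟩
    · exact h'
    · omega
  refine isPlanar_of_twoPage _ {e | ∃ x w, e = s(x, w) ∧ w.1.length = x.1.length + 1} ?_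
  intro x y w z hxy hyw hwz hadj hadj'
  obtain ⟨hp, h⟩ := key x w (hxy.trans hyw) hadj
  obtain ⟨hp', h'⟩ := key y z (hyw.trans hwz) hadj'
  rw [mem x w hp, mem y z hp']
  have hyw' : y.1 <+: w.1 := prefix_of_le_of_le hp' hyw.le hwz.le
  have hxy' : x.1 <+: y.1 := by
    rcases List.prefix_or_prefix_of_prefix hp hyw' with h | h
    · exact h
    · exact absurd hxy (not_lt_of_ge (le_of_prefix h))
  have l1 : x.1.length < y.1.length := lt_of_le_of_ne hxy'.length_le fun h =>
    hxy.ne (Subtype.ext (hxy'.eq_of_length h))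
  have l2 : y.1.length < w.1.length := lt_of_le_of_ne hyw'.length_le fun h =>
    hyw.ne (Subtype.ext (hyw'.eq_of_length h))
  intro hiff
  rcases h with h | ⟨⟨k, hk⟩, h⟩
  · omega
  rcases h' with h' | ⟨⟨k', hk'⟩, h'⟩
  · have := hiff.2 h'
    omega
  have h1 : D * k < D * k' := by omega
  have h2 : D * k' < D * (k + 1) := by rw [mul_add]; omega
  have := Nat.lt_of_mul_lt_mul_left h1
  have := Nat.lt_of_mul_lt_mul_left h2
  omega

/-! ### Ancestors in the tree, and the tree decomposition of width two. -/

theorem length_take (k : ℕ) (v : Word α n) : (take k v).1.length = min k v.1.length :=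
  List.length_take

theorem take_prefix (k : ℕ) (v : Word α n) : (take k v).1 <+: v.1 := List.take_prefix k v.1

theorem take_take (j k : ℕ) (v : Word α n) : take j (take k v) = take (min j k) v :=
  Subtype.ext List.take_take

theorem take_of_length_le {k : ℕ} {v : Word α n} (h : v.1.length ≤ k) : take k v = v :=
  Subtype.ext (List.take_of_length_le h)

theorem eq_take_of_prefix {x v : Word α n} (h : x.1 <+: v.1) : x = take x.1.length v :=
  Subtype.ext (List.prefix_iff_eq_take.1 h)

theorem tree_adj_take {v : Word α n} (hv : v.1.length ≠ 0) :
    (tree α n).Adj (take (v.1.length - 1) v) v := by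
  have hl := length_take (v.1.length - 1) v
  rw [tree, SimpleGraph.fromRel_adj]
  refine ⟨fun h => ?_, Or.inl ⟨take_prefix _ v, by omega⟩⟩
  rw [h] at hl
  omega

/-- Passing to parents stays in `s` and can only stop at `x`. -/
theorem connected_induce_tree (s : Set (Word α n)) (x : Word α n) (hx : x ∈ s)
    (hs : ∀ v ∈ s, v ≠ x → v.1.length ≠ 0 ∧ take (v.1.length - 1) v ∈ s) :
    ((tree α n).induce s).Connected := by
  rw [SimpleGraph.connected_iff_exists_forall_reachable]
  refine ⟨⟨x, hx⟩, ?_⟩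
  suffices h : ∀ k, ∀ v : Word α n, ∀ hv : v ∈ s, v.1.length = k →
      ((tree α n).induce s).Reachable ⟨x, hx⟩ ⟨v, hv⟩ from fun w => h _ w.1 w.2 rfl
  intro k
  induction k with
  | zero =>
    intro v hv hk
    by_cases hvx : v = x
    · subst hvx; rfl
    · exact absurd hk (hs v hv hvx).1
  | succ k ih =>
    intro v hv hk
    by_cases hvx : v = x
    · subst hvx; rfl
    · obtain ⟨h0, hp⟩ := hs v hv hvx
      refine (ih _ hp (by rw [length_take]; omega)).trans (SimpleGraph.Adj.reachable ?_)
      exact tree_adj_take h0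

theorem isTree_tree (α : Type) [Finite α] (n : ℕ) : (tree α n).IsTree := by
  classical
  have hroot : ∀ v : Word α n, v.1.length = 0 → v = ⟨[], Nat.zero_le n⟩ := fun v hv =>
    Subtype.ext (List.length_eq_zero_iff.1 hv)
  have hconn : (tree α n).Connected := by
    have h := connected_induce_tree (Set.univ : Set (Word α n)) ⟨[], Nat.zero_le n⟩ trivial
      fun v _ hv => ⟨fun h0 => hv (hroot v h0), trivial⟩
    exact (SimpleGraph.induceUnivIso (tree α n)).connected_iff.1 h
  rw [SimpleGraph.isTree_iff_connected_and_card]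
  refine ⟨hconn, le_antisymm ?_ hconn.card_vert_le_card_edgeSet_add_one⟩
  -- Every edge joins a non-root vertex to its parent, which bounds the number of edges.
  have hsurj : Function.Surjective
      fun v : {v : Word α n // v ≠ ⟨[], Nat.zero_le n⟩} =>
        (⟨s(take (v.1.1.length - 1) v.1, v.1), tree_adj_take fun h => v.2 (hroot _ h)⟩ :
          (tree α n).edgeSet) := by
    have key : ∀ x w : Word α n, x.1 <+: w.1 ∧ w.1.length = x.1.length + 1 →
        ∃ v : {v : Word α n // v ≠ ⟨[], Nat.zero_le n⟩},
          s(take (v.1.1.length - 1) v.1, v.1) = s(x, w) := by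
      rintro x w ⟨hp, hl⟩
      refine ⟨⟨w, fun h => ?_⟩, ?_⟩
      · rw [h] at hl
        simp at hl
      · dsimp only
        rw [show w.1.length - 1 = x.1.length by omega, ← eq_take_of_prefix hp]
    rintro ⟨e, he⟩
    induction e using Sym2.ind with
    | _ x w =>
      have he' := he
      rw [SimpleGraph.mem_edgeSet, tree, SimpleGraph.fromRel_adj] at he'
      rcases he'.2 with h | h
      · obtain ⟨v, hv⟩ := key x w h
        exact ⟨v, Subtype.ext hv⟩
      · obtain ⟨v, hv⟩ := key w x h
        exact ⟨v, Subtype.ext (hv.trans Sym2.eq_swap)⟩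
  have h1 : Nat.card (tree α n).edgeSet ≤ _ := Nat.card_le_card_of_surjective _ hsurj
  have h2 : Nat.card {v : Word α n // v ≠ ⟨[], Nat.zero_le n⟩} + 1 = Nat.card (Word α n) := by
    have := Fintype.ofFinite (Word α n)
    rw [Nat.card_eq_fintype_card, Nat.card_eq_fintype_card, Fintype.card_subtype_compl,
      Fintype.card_subtype_eq]
    exact Nat.sub_add_cancel (Fintype.card_pos_iff.2 ⟨⟨[], Nat.zero_le n⟩⟩)
  omega

open Classical in
/-- The bag of a vertex `v` consists of `v`, its parent, and its closest proper ancestor whose depth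
is a multiple of `D`. -/
noncomputable def skipDecomposition (α : Type) [Finite α] (n D : ℕ) (hD : 0 < D) :
    TreeDecomposition (skipTree α n D) where
  Node := Word α n
  finite_node := inferInstance
  tree := tree α n
  isTree := isTree_tree α n
  bag v := {v, take (v.1.length - 1) v, take (D * ((v.1.length - 1) / D)) v}
  exists_mem_bag v := ⟨v, by simp⟩
  exists_edge_bag := by
    have key : ∀ x w : Word α n, x.1 <+: w.1 ∧ (w.1.length = x.1.length + 1 ∨
        D ∣ x.1.length ∧ w.1.length = x.1.length + D) →
        x ∈ ({w, take (w.1.length - 1) w, take (D * ((w.1.length - 1) / D)) w} :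
          Finset (Word α n)) := by
      rintro x w ⟨hp, h | ⟨⟨k, hk⟩, h⟩⟩
      · have : x = take (w.1.length - 1) w := by
          rw [h, Nat.add_sub_cancel]
          exact eq_take_of_prefix hp
        simp [← this]
      -- Subtracting 1 before dividing selects a proper ancestor even when the depth of `w` is
      -- itself a multiple of `D`.
      · have hd : (w.1.length - 1) / D = k := by
          rw [Nat.div_eq_iff hD, h, hk, mul_comm]
          constructor <;> omega
        have : x = take (D * ((w.1.length - 1) / D)) w := by
          rw [hd, ← hk]
          exact eq_take_of_prefix hp
        simp [← this]
    intro u v huv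
    rw [skipTree, SimpleGraph.fromRel_adj] at huv
    rcases huv.2 with h | h
    · exact ⟨v, key u v h, by simp⟩
    · exact ⟨u, by simp, key v u h⟩
  connected_bags x := by
    refine connected_induce_tree _ x (by simp) fun v hv hvx => ?_
    simp only [Set.mem_ofPred_eq, Finset.mem_insert, Finset.mem_singleton] at hv ⊢
    have h0 : v.1.length ≠ 0 := by
      intro h0
      have : ∀ k, take k v = v := fun k => take_of_length_le (by omega)
      simp only [this, or_self] at hv
      exact hvx hv.symm
    refine ⟨h0, ?_⟩
    rcases hv with h | h | h
    · exact absurd h.symm hvx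
    · exact Or.inl h
    · have hdiv := Nat.div_mul_le_self (v.1.length - 1) D
      rw [mul_comm] at hdiv
      -- The closest special proper ancestor of `v` is either the parent of `v` or also the closest
      -- special proper ancestor of that parent.
      rcases hdiv.lt_or_eq with hlt | heq
      · refine Or.inr (Or.inr ?_)
        have hd : (v.1.length - 1 - 1) / D = (v.1.length - 1) / D := by
          refine le_antisymm (Nat.div_le_div_right (Nat.sub_le _ _)) ?_
          rw [Nat.le_div_iff_mul_le hD, mul_comm]
          omega
        rw [length_take, take_take, min_eq_left (Nat.sub_le _ _), hd, min_eq_left hdiv]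
        exact h
      · rw [heq] at h
        exact Or.inl h

theorem treewidth_skipTree_le (α : Type) [Finite α] (n D : ℕ) (hD : 0 < D) :
    treewidth (skipTree α n D) ≤ 2 :=
  Nat.sInf_le ⟨skipDecomposition α n D hD, fun _ => by classical exact Finset.card_le_three⟩

end Word

/-! ### Elimination forests -/

theorem RootedForest.IsAncestor.eq_or_depth_lt {V : Type*} {F : RootedForest V} {u v : V}
    (h : F.IsAncestor u v) : u = v ∨ F.depth u < F.depth v := by
  induction h with
  | refl => exact Or.inl rfl
  | tail _ h ih =>
    have := F.depth_child _ _ h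
    rcases ih with rfl | ih
    · exact Or.inr (by omega)
    · exact Or.inr (by omega)

/-- The ancestors of `w` form a chain along which depth strictly increases. -/
theorem RootedForest.IsAncestor.eq_of_depth_eq {V : Type*} {F : RootedForest V} {u v w : V}
    (hu : F.IsAncestor u w) (hv : F.IsAncestor v w) (h : F.depth u = F.depth v) : u = v := by
  have hcomp : F.IsAncestor u v ∨ F.IsAncestor v u := by
    clear h
    induction hu with
    | refl => exact Or.inr hv
    | tail hub hbc ih =>
      rcases Relation.ReflTransGen.cases_tail hv with rfl | ⟨d, hvd, hdc⟩
      · exact Or.inl (hub.tail hbc)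
      · obtain rfl := Option.some.inj (hbc.symm.trans hdc)
        exact ih hvd
  rcases hcomp with h' | h'
  · exact h'.eq_or_depth_lt.resolve_right (by omega)
  · exact (h'.eq_or_depth_lt.resolve_right (by omega)).symm

/-- Every finite graph has an elimination forest of depth less than its treedepth. -/
theorem exists_forest_of_treedepth {V : Type*} [Finite V] (G : SimpleGraph V) :
    ∃ F : RootedForest V, (∀ v, F.depth v < treedepth G) ∧
      ∀ u v, G.Adj u v → F.IsAncestor u v ∨ F.IsAncestor v u := by
  refine Nat.sInf_mem (s := {d : ℕ | ∃ F : RootedForest V, (∀ v, F.depth v < d) ∧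
    ∀ u v, G.Adj u v → F.IsAncestor u v ∨ F.IsAncestor v u}) ?_
  -- A single path through all vertices shows that the infimum is over a nonempty set, hence
  -- attained.
  obtain ⟨N, ⟨e⟩⟩ := Finite.exists_equiv_fin V
  let F : RootedForest V :=
    { parent := fun v => if h : (e v : ℕ) = 0 then none else
        some (e.symm ⟨(e v : ℕ) - 1, by omega⟩)
      depth := fun v => e v
      depth_root := by
        intro v hv
        by_contra h
        rw [dif_neg h] at hv
        simp at hv
      depth_child := by
        intro v p hv
        split_ifs at hv with h
        rw [← Option.some.inj hv, Equiv.apply_symm_apply]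
        dsimp only
        omega }
  refine ⟨N, F, fun v => (e v).2, ?_⟩
  have key : ∀ k (u v : V), (e v : ℕ) = e u + k → F.IsAncestor u v := by
    intro k
    induction k with
    | zero =>
      intro u v h
      rw [e.injective (Fin.ext (h.trans (Nat.add_zero _)))]
      exact .refl
    | succ k ih =>
      intro u v h
      have hv : (e v : ℕ) ≠ 0 := by omega
      refine (ih u (e.symm ⟨(e v : ℕ) - 1, by omega⟩) ?_).tail (show F.parent v = _ from dif_neg hv)
      rw [Equiv.apply_symm_apply]
      dsimp only
      omega
  intro u v _
  rcases le_total (e u : ℕ) (e v) with h | h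
  · exact Or.inl (key (e v - e u) u v (by omega))
  · exact Or.inr (key (e u - e v) v u (by omega))

/-- The elimination forest of `G - Y`, described in terms of `G`. -/
theorem exists_depth_of_treedepth_induce {V : Type*} [Finite V] (G : SimpleGraph V) (Y : Set V) :
    ∃ (depth : V → ℕ) (anc : V → V → Prop), (∀ v ∉ Y, depth v < treedepth (G.induce Yᶜ)) ∧
      (∀ u ∉ Y, ∀ v ∉ Y, G.Adj u v → anc u v ∨ anc v u) ∧
      (∀ u v, anc u v → u = v ∨ depth u < depth v) ∧
      (∀ u v, anc u v → u ∉ Y) ∧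
      ∀ u v w, anc u w → anc v w → depth u = depth v → u = v := by
  classical
  obtain ⟨F, hF, hadj⟩ := exists_forest_of_treedepth (G.induce Yᶜ)
  have hd : ∀ u : (Yᶜ : Set V),
      (if h : u.1 ∈ Yᶜ then F.depth ⟨u.1, h⟩ else 0) = F.depth u := fun u => dif_pos u.2
  -- Deleted vertices get the junk depth 0 and are related to nothing by `anc`.
  refine ⟨fun v => if h : v ∈ Yᶜ then F.depth ⟨v, h⟩ else 0,
    fun u v => ∃ (hu : u ∈ Yᶜ) (hv : v ∈ Yᶜ), F.IsAncestor ⟨u, hu⟩ ⟨v, hv⟩, ?_, ?_, ?_, ?_, ?_⟩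
  · intro v hv
    exact (hd ⟨v, hv⟩).trans_lt (hF _)
  · intro u hu v hv huv
    exact (hadj ⟨u, hu⟩ ⟨v, hv⟩ huv).imp (fun h => ⟨hu, hv, h⟩) fun h => ⟨hv, hu, h⟩
  · rintro u v ⟨hu, hv, h⟩
    have := h.eq_or_depth_lt
    rw [Subtype.mk.injEq, ← hd, ← hd] at this
    exact this
  · rintro u v ⟨hu, -⟩
    exact hu
  · rintro u v w ⟨hu, hw, h⟩ ⟨hv, _, h'⟩ huv
    exact congrArg Subtype.val
      (h.eq_of_depth_eq h' ((hd ⟨u, hu⟩).symm.trans (huv.trans (hd ⟨v, hv⟩))))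

/-! ### Choosing a thin set -/

/-- For any weights, some set in the support of an `ε`-thin distribution has at most an `ε`-fraction
of the total weight. -/
theorem IsThin.exists_sum_le {V : Type*} [Finite V] {ε : ℝ} (hε : 0 ≤ ε) {p : PMF (Set V)}
    (hp : IsThin ε p) {ι : Type*} (s : Finset ι) (w : ι → ℝ) (hw : ∀ i ∈ s, 0 ≤ w i) (x : ι → V) :
    ∃ Y ∈ p.support, ∑ i ∈ s, w i * Y.indicator 1 (x i) ≤ ε * ∑ i ∈ s, w i := by
  classical
  have := Fintype.ofFinite (Set V)
  by_contra! hcon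
  have hsum : ∑ Y, (p Y).toReal = 1 := by
    rw [← ENNReal.toReal_sum fun Y _ => p.apply_ne_top Y, ← tsum_fintype (L := .unconditional _),
      p.tsum_coe, ENNReal.toReal_one]
  have hprob : ∀ v, ∑ Y : Set V, (p Y).toReal * Y.indicator 1 v ≤ ε := by
    intro v
    have h := hp v
    rw [PMF.toOuterMeasure_apply_fintype] at h
    have h' := ENNReal.toReal_mono ENNReal.ofReal_ne_top h
    rw [ENNReal.toReal_ofReal hε, ENNReal.toReal_sum] at h'
    · refine le_trans (le_of_eq (Finset.sum_congr rfl fun Y _ => ?_)) h'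
      by_cases hv : v ∈ Y
      · simp [Set.indicator, hv]
      · simp [Set.indicator, hv]
    · intro Y _
      exact ne_top_of_le_ne_top (p.apply_ne_top Y) (Set.indicator_le_self _ _ Y)
  -- Linearity of expectation bounds the mean weight; if every set in the support exceeded the
  -- bound, so would the mean.
  have hupper : ∑ Y : Set V, (p Y).toReal * ∑ i ∈ s, w i * Y.indicator 1 (x i) ≤
      ε * ∑ i ∈ s, w i := by
    calc ∑ Y : Set V, (p Y).toReal * ∑ i ∈ s, w i * Y.indicator 1 (x i)
        = ∑ i ∈ s, w i * ∑ Y : Set V, (p Y).toReal * Y.indicator 1 (x i) := by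
          simp_rw [Finset.mul_sum]
          rw [Finset.sum_comm]
          exact Finset.sum_congr rfl fun i _ => Finset.sum_congr rfl fun Y _ => by ring
      _ ≤ ∑ i ∈ s, w i * ε :=
          Finset.sum_le_sum fun i hi => mul_le_mul_of_nonneg_left (hprob (x i)) (hw i hi)
      _ = ε * ∑ i ∈ s, w i := by rw [← Finset.sum_mul, mul_comm]
  obtain ⟨Y₀, hY₀⟩ := p.support_nonempty
  have hlower : ∑ Y : Set V, (p Y).toReal * (ε * ∑ i ∈ s, w i) <
      ∑ Y : Set V, (p Y).toReal * ∑ i ∈ s, w i * Y.indicator 1 (x i) := by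
    refine Finset.sum_lt_sum (fun Y _ => ?_) ⟨Y₀, Finset.mem_univ _, ?_⟩
    · by_cases hY : Y ∈ p.support
      · exact mul_le_mul_of_nonneg_left (hcon Y hY).le ENNReal.toReal_nonneg
      · rw [(p.apply_eq_zero_iff Y).2 hY]
        simp
    · exact mul_lt_mul_of_pos_left (hcon Y₀ hY₀)
        (ENNReal.toReal_pos ((p.mem_support_iff Y₀).1 hY₀) (p.apply_ne_top Y₀))
  rw [← Finset.sum_mul, hsum, one_mul] at hlower
  linarith

/-! ### Depths along a branch -/

/-- Consider a sequence of positions `0, …, m * D`, some of which are deleted, and depths which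
increase between consecutive positions and between consecutive multiples of `D`. The last depth is
at least `D` times the number of segments without deleted positions, unless a multiple of `D` is
deleted. -/
theorem mul_le_add_mul_sum {m D d : ℕ} (P : ℕ → Prop) [DecidablePred P] (δ : ℕ → ℕ)
    (hstep : ∀ k < m * D, ¬ P k → ¬ P (k + 1) → δ k < δ (k + 1))
    (hskip : ∀ k < m, ¬ P (k * D) → ¬ P ((k + 1) * D) → δ (k * D) < δ ((k + 1) * D))
    (hd : ∀ k, ¬ P k → δ k < d) :
    D * m ≤ d + D * ∑ k ∈ Finset.range (m * D + 1),
      (1 + if D ∣ k then m else 0) * (if P k then 1 else 0) := by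
  -- A deleted multiple of `D` has weight `m + 1`, which alone pays for the left-hand side.
  by_cases hP : ∃ k ≤ m, P (k * D)
  · obtain ⟨k, hk, hPk⟩ := hP
    have hmem : k * D ∈ Finset.range (m * D + 1) :=
      Finset.mem_range.2 (Nat.lt_succ_of_le (Nat.mul_le_mul_right D hk))
    have := Finset.single_le_sum (f := fun k => (1 + if D ∣ k then m else 0) *
      (if P k then 1 else 0)) (fun _ _ => Nat.zero_le _) hmem
    simp only [dvd_mul_left, if_true, hPk, mul_one] at this
    exact le_add_left (Nat.mul_le_mul_left D (by omega))
  push Not at hP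
  have key : ∀ k ≤ m, D * k ≤ δ (k * D) +
      D * ∑ j ∈ Finset.range (k * D + 1), (if P j then 1 else 0) := by
    intro k
    induction k with
    | zero => intro _; simp
    | succ k ih =>
      intro hk
      have ih := ih (by omega)
      have hsub : k * D + 1 ≤ (k + 1) * D + 1 := by rw [add_mul]; omega
      have hsplit := Finset.sum_range_add_sum_Ico (fun j => if P j then 1 else 0) hsub
      -- A damaged segment is paid for by its deleted position, the skip keeping the depth from
      -- dropping; an intact one gains `D` through its single steps.
      by_cases hfull : ∃ j, k * D < j ∧ j < (k + 1) * D + 1 ∧ P j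
      · obtain ⟨j, hj1, hj2, hPj⟩ := hfull
        have h1 : 1 ≤ ∑ j ∈ Finset.Ico (k * D + 1) ((k + 1) * D + 1), (if P j then 1 else 0) := by
          have := Finset.single_le_sum (f := fun j => if P j then 1 else 0)
            (fun _ _ => Nat.zero_le _) (Finset.mem_Ico.2 ⟨hj1, hj2⟩)
          simpa [hPj] using this
        have h2 := hskip k (by omega) (hP k (by omega)) (hP (k + 1) hk)
        have h3 := Nat.mul_le_mul_left D h1
        rw [← hsplit, mul_add, mul_add]
        omega
      · push Not at hfull
        have hrun : ∀ i ≤ D, δ (k * D) + i ≤ δ (k * D + i) := by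
          intro i
          induction i with
          | zero => intro _; simp
          | succ i ihi =>
            intro hi
            have hlt : k * D + i < (k + 1) * D := by rw [add_mul]; omega
            have hnot : ¬ P (k * D + i) := by
              rcases Nat.eq_zero_or_pos i with rfl | h
              · exact hP k (by omega)
              · exact hfull _ (by omega) (by omega)
            have := hstep (k * D + i) (hlt.trans_le (Nat.mul_le_mul_right D hk)) hnot
              (hfull _ (by omega) (by omega))
            have := ihi (by omega)
            rw [← add_assoc, ← add_assoc]
            omega
        have h1 := hrun D le_rfl
        rw [← hsplit, mul_add, mul_add, mul_one, show (k + 1) * D = k * D + D by ring]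
        omega
  have h1 := key m le_rfl
  have h2 := hd _ (hP m le_rfl)
  have h3 : ∑ j ∈ Finset.range (m * D + 1), (if P j then 1 else 0) ≤
      ∑ k ∈ Finset.range (m * D + 1), (1 + if D ∣ k then m else 0) * (if P k then 1 else 0) :=
    Finset.sum_le_sum fun j _ => Nat.le_mul_of_pos_left _ (by omega)
  have := Nat.mul_le_mul_left D h3
  omega

/-! ### Branches of the tree -/

namespace Word

variable {α : Type} {n : ℕ}

/-- The vertex at depth `k` on the branch `l`. -/
def node (l : Fin n → α) (k : ℕ) : Word α n :=
  ⟨(List.ofFn l).take k, (List.length_take_le' _ _).trans (List.length_ofFn).le⟩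

theorem length_node (l : Fin n → α) {k : ℕ} (hk : k ≤ n) : (node l k).1.length = k := by
  simp [node, hk]

theorem node_prefix (l : Fin n → α) {i j : ℕ} (h : i ≤ j) : (node l i).1 <+: (node l j).1 :=
  List.take_prefix_take_left h

theorem node_eq_iff (l l' : Fin n → α) (k : ℕ) :
    node l k = node l' k ↔ ∀ t : Fin n, t < k → l t = l' t := by
  rw [Subtype.ext_iff]
  constructor
  · intro h t ht
    have := congrArg (fun x => x[t]?) h
    simpa [node, List.getElem?_take, ht] using this
  · intro h
    refine List.ext_getElem (by simp [node]) fun t h1 h2 => ?_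
    have h3 : t < min k n := by simpa [node] using h1
    simpa [node] using h ⟨t, by omega⟩ (show t < k by omega)

theorem skipTree_adj_node {D : ℕ} (l : Fin n → α) {i j : ℕ} (hij : i < j) (hj : j ≤ n)
    (h : j = i + 1 ∨ D ∣ i ∧ j = i + D) : (skipTree α n D).Adj (node l i) (node l j) := by
  have hi' := length_node l (hij.le.trans hj)
  have hj' := length_node l hj
  rw [skipTree, SimpleGraph.fromRel_adj]
  refine ⟨fun he => ?_, Or.inl ⟨node_prefix l hij.le, ?_⟩⟩
  · rw [he] at hi'
    omega
  · rwa [hi', hj']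

open Classical in
/-- If each vertex has at most one ancestor of each depth less than `d`, then few branches have
their vertex at depth `j` as an ancestor of their vertex at depth `i < j`. -/
theorem card_branches_mul_le [Fintype α] {d : ℕ} (depth : Word α n → ℕ)
    (anc : Word α n → Word α n → Prop) (hd : ∀ u v, anc u v → depth u < d)
    (huniq : ∀ u v w, anc u w → anc v w → depth u = depth v → u = v) {i j : ℕ} (hij : i < j)
    (hj : j ≤ n) :
    (Finset.univ.filter fun l : Fin n → α => anc (node l j) (node l i)).card * Fintype.card α ≤
      Fintype.card (Fin n → α) * d := by
  have hin : i < n := hij.trans_le hj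
  have := Fintype.card_le_of_injective
    (fun q : {l : Fin n → α // anc (node l j) (node l i)} × α =>
      ((Function.update q.1.1 ⟨i, hin⟩ q.2, ⟨depth (node q.1.1 j), hd _ _ q.1.2⟩) :
        (Fin n → α) × Fin d)) ?_
  · rwa [Fintype.card_prod, Fintype.card_prod, Fintype.card_fin, Fintype.card_subtype] at this
  rintro ⟨⟨l, hl⟩, c⟩ ⟨⟨l', hl'⟩, c'⟩ h
  simp only [Prod.mk.injEq, Fin.mk.injEq] at h
  obtain ⟨h1, h2⟩ := h
  have hc : c = c' := by simpa using congrFun h1 ⟨i, hin⟩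
  have hne : ∀ t, t ≠ ⟨i, hin⟩ → l t = l' t := fun t ht => by
    simpa [Function.update_of_ne ht] using congrFun h1 t
  have hi : node l i = node l' i :=
    (node_eq_iff l l' i).2 fun t ht => hne t fun he => by simp [he] at ht
  rw [hi] at hl
  have hjj := huniq _ _ _ hl hl' h2
  have hll : l = l' := by
    funext t
    by_cases ht : t = ⟨i, hin⟩
    · exact (node_eq_iff l l' j).1 hjj t (by rw [ht]; exact hij)
    · exact hne t ht
  simp [hll, hc]

open Classical in
/-- The treedepth of the tree with skips after the deletion of `Y`, compared with the weight of `Y`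
along the branches. -/
theorem sum_branches_le [Fintype α] {m D : ℕ} (hD : 0 < D) (Y : Set (Word α (m * D))) :
    ∃ B : ℕ, B * Fintype.card α ≤ (m * D + m) *
        (Fintype.card (Fin (m * D) → α) * treedepth ((skipTree α (m * D) D).induce Yᶜ)) ∧
      Fintype.card (Fin (m * D) → α) * (D * m) ≤
        Fintype.card (Fin (m * D) → α) * treedepth ((skipTree α (m * D) D).induce Yᶜ) +
        D * ∑ l : Fin (m * D) → α, ∑ k ∈ Finset.range (m * D + 1),
          (1 + if D ∣ k then m else 0) * (if node l k ∈ Y then 1 else 0) + D * m * B := by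
  obtain ⟨depth, anc, hdepth, hadj, hlt, hmem, huniq⟩ :=
    exists_depth_of_treedepth_induce (skipTree α (m * D) D) Y
  set d := treedepth ((skipTree α (m * D) D).induce Yᶜ)
  set S : Finset (ℕ × ℕ) := (Finset.range (m * D)).image (fun k => (k, k + 1)) ∪
    (Finset.range m).image (fun k => (k * D, (k + 1) * D)) with hS
  have hScard : S.card ≤ m * D + m :=
    (Finset.card_union_le _ _).trans (add_le_add
      (Finset.card_image_le.trans (Finset.card_range _).le)
      (Finset.card_image_le.trans (Finset.card_range _).le))
  have hSmem : ∀ q ∈ S, q.1 < q.2 ∧ q.2 ≤ m * D ∧ (q.2 = q.1 + 1 ∨ D ∣ q.1 ∧ q.2 = q.1 + D) := by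
    intro q hq
    rw [hS, Finset.mem_union, Finset.mem_image, Finset.mem_image] at hq
    rcases hq with ⟨k, hk, rfl⟩ | ⟨k, hk, rfl⟩
    · rw [Finset.mem_range] at hk
      exact ⟨Nat.lt_succ_self k, hk, Or.inl rfl⟩
    · rw [Finset.mem_range] at hk
      exact ⟨Nat.mul_lt_mul_of_pos_right (Nat.lt_succ_self k) hD, Nat.mul_le_mul_right D hk,
        Or.inr ⟨dvd_mul_left D k, by ring⟩⟩
  refine ⟨∑ q ∈ S, (Finset.univ.filter fun l : Fin (m * D) → α =>
    anc (node l q.2) (node l q.1)).card, ?_, ?_⟩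
  · rw [Finset.sum_mul]
    refine (Finset.sum_le_card_nsmul S _ _ fun q hq => card_branches_mul_le depth anc
      (fun u v h => hdepth u (hmem u v h)) huniq (hSmem q hq).1 (hSmem q hq).2.1).trans ?_
    rw [smul_eq_mul]
    exact Nat.mul_le_mul_right _ hScard
  · simp_rw [Finset.card_filter]
    rw [Finset.sum_comm (s := S)]
    suffices hpt : ∀ l : Fin (m * D) → α, D * m ≤ d + D * (∑ k ∈ Finset.range (m * D + 1),
        (1 + if D ∣ k then m else 0) * (if node l k ∈ Y then 1 else 0)) +
        D * m * ∑ q ∈ S, (if anc (node l q.2) (node l q.1) then 1 else 0) by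
      have h := Finset.sum_le_sum fun l (_ : l ∈ Finset.univ) => hpt l
      rwa [Finset.sum_add_distrib, Finset.sum_add_distrib, Finset.sum_const, Finset.sum_const,
        ← Finset.mul_sum, ← Finset.mul_sum, Finset.card_univ, smul_eq_mul, smul_eq_mul] at h
    intro l
    by_cases hbad : ∃ q ∈ S, anc (node l q.2) (node l q.1)
    · obtain ⟨q, hq, hanc⟩ := hbad
      have := Finset.single_le_sum
        (f := fun q : ℕ × ℕ => if anc (node l q.2) (node l q.1) then 1 else 0)
        (fun _ _ => Nat.zero_le _) hq
      simp only [hanc, if_true] at this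
      exact le_add_left (Nat.le_mul_of_pos_right _ this)
    · push Not at hbad
      have hinc : ∀ i j, (i, j) ∈ S → node l i ∉ Y → node l j ∉ Y →
          depth (node l i) < depth (node l j) := by
        intro i j hq hi hj
        obtain ⟨h1, h2, h3⟩ := hSmem _ hq
        have hA := skipTree_adj_node l h1 h2 h3
        have := (hadj _ hi _ hj hA).resolve_right (hbad _ hq)
        exact (hlt _ _ this).resolve_left hA.ne
      refine le_add_right (mul_le_add_mul_sum (fun k => node l k ∈ Y) (fun k => depth (node l k))
        (fun k hk => hinc _ _ ?_) (fun k hk => hinc _ _ ?_) fun k hk => hdepth _ hk)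
      · exact Finset.mem_union_left _ (Finset.mem_image_of_mem _ (Finset.mem_range.2 hk))
      · exact Finset.mem_union_right _ (Finset.mem_image.2 ⟨k, Finset.mem_range.2 hk, rfl⟩)

end Word

/-- The total weight of the positions along a branch. -/
theorem sum_weights_le {m D : ℕ} (hD : 0 < D) :
    ∑ k ∈ Finset.range (m * D + 1), (1 + if D ∣ k then m else 0) ≤
      m * D + 1 + m * (m + 1) := by
  rw [Finset.sum_add_distrib, Finset.sum_const, Finset.card_range, smul_eq_mul, mul_one,
    ← Finset.sum_filter, Finset.sum_const, smul_eq_mul, mul_comm _ m]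
  refine Nat.add_le_add_left (Nat.mul_le_mul_left m ?_) _
  have hsub : (Finset.range (m * D + 1)).filter (D ∣ ·) ⊆
      (Finset.range (m + 1)).image (D * ·) := by
    intro k hk
    obtain ⟨hk, t, rfl⟩ := Finset.mem_filter.1 hk
    refine Finset.mem_image.2 ⟨t, Finset.mem_range.2 (Nat.lt_succ_of_le ?_), rfl⟩
    refine Nat.le_of_mul_le_mul_left ?_ hD
    rw [Finset.mem_range] at hk
    rw [mul_comm D m]
    omega
  exact (Finset.card_le_card hsub).trans (Finset.card_image_le.trans (Finset.card_range _).le)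

/-- Trees with skips force the rate to be large. -/
theorem sq_le_two_mul_of_fragile (r : ℕ → ℝ≥0)
    (hfrag : ∀ (V : Type) [Finite V] (G : SimpleGraph V), IsPlanar G → treewidth G ≤ 2 →
      FractionallyFragile td r G) {a m : ℕ} (hm : 0 < m) (ha : 16 * m ≤ a) :
    (m : ℝ) ^ 2 ≤ 2 * r a := by
  classical
  set R := ⌈(r a : ℝ)⌉₊
  set b := 16 * (m * m) * (R + 1) with hb
  have hbpos : 0 < b := by positivity
  have hapos : 0 < a := by omega
  obtain ⟨p, hsupp, hthin⟩ := hfrag (Word (Fin b) (m * m)) (Word.skipTree (Fin b) (m * m) m)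
    (Word.isPlanar_skipTree _ _ _) (Word.treewidth_skipTree_le _ _ _ hm) a hapos
  obtain ⟨w, hw⟩ : ∃ w : ℕ → ℕ, ∀ k, w k = 1 + if m ∣ k then m else 0 := ⟨_, fun _ => rfl⟩
  obtain ⟨Y, hY, hsum⟩ := hthin.exists_sum_le (by positivity)
    ((Finset.univ : Finset (Fin (m * m) → Fin b)) ×ˢ Finset.range (m * m + 1))
    (fun q => (w q.2 : ℝ)) (fun _ _ => Nat.cast_nonneg _)
    (fun q => Word.node q.1 q.2)
  have htd : (treedepth ((Word.skipTree (Fin b) (m * m) m).induce Yᶜ) : ℝ) ≤ r a := hsupp hY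
  obtain ⟨B, hB, hmain⟩ := Word.sum_branches_le (α := Fin b) hm Y
  set d := treedepth ((Word.skipTree (Fin b) (m * m) m).induce Yᶜ)
  set N := Fintype.card (Fin (m * m) → Fin b) with hN
  have hNpos : 0 < N := Fintype.card_pos_iff.2 ⟨fun _ => ⟨0, hbpos⟩⟩
  rw [Finset.sum_product, Finset.sum_product] at hsum
  dsimp only at hsum
  rw [Finset.sum_const, Finset.card_univ, ← hN, nsmul_eq_mul] at hsum
  set C := ∑ l : Fin (m * m) → Fin b, ∑ k ∈ Finset.range (m * m + 1),
    (1 + if m ∣ k then m else 0) * (if Word.node l k ∈ Y then 1 else 0) with hC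
  have hsum' : (C : ℝ) ≤ 1 / a * (N * (4 * m ^ 2)) := by
    refine le_trans (le_of_eq ?_) (hsum.trans ?_)
    · rw [hC, Nat.cast_sum]
      refine Finset.sum_congr rfl fun l _ => ?_
      rw [Nat.cast_sum]
      refine Finset.sum_congr rfl fun k _ => ?_
      rw [Nat.cast_mul, ← hw]
      by_cases h : Word.node l k ∈ Y <;> simp [h]
    · have hW := sum_weights_le (m := m) hm
      have hW' : m * m + 1 + m * (m + 1) ≤ 4 * m ^ 2 := by nlinarith
      simp_rw [← hw] at hW
      have : ((∑ k ∈ Finset.range (m * m + 1), w k : ℕ) : ℝ) ≤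
          4 * (m : ℝ) ^ 2 := by exact_mod_cast hW.trans hW'
      rw [← Nat.cast_sum]
      gcongr
  have hCle : (C : ℝ) * 4 ≤ N * m := by
    have ha' : (16 : ℝ) * m ≤ a := by exact_mod_cast ha
    have ha0 : (0 : ℝ) < a := by exact_mod_cast hapos
    have h1 : (a : ℝ) * C ≤ N * (4 * m ^ 2) := by
      calc (a : ℝ) * C ≤ a * (1 / a * (N * (4 * m ^ 2))) := by gcongr
        _ = N * (4 * m ^ 2) := by field_simp
    have h2 : (16 : ℝ) * m * C ≤ a * C := by gcongr
    have hm' : (0 : ℝ) < 4 * m := by positivity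
    refine le_of_mul_le_mul_left ?_ hm'
    nlinarith
  have hBle : B * 8 ≤ N := by
    have hdR : d ≤ R := by exact_mod_cast htd.trans (Nat.le_ceil _)
    rw [Fintype.card_fin] at hB
    have h1 : (m * m + m) * (N * d) ≤ (2 * (m * m)) * (N * (R + 1)) :=
      Nat.mul_le_mul (by nlinarith) (Nat.mul_le_mul_left N (by omega))
    have hpos : 0 < 2 * (m * m) * (R + 1) := by positivity
    refine Nat.le_of_mul_le_mul_left ?_ hpos
    calc 2 * (m * m) * (R + 1) * (B * 8) = B * b := by rw [hb]; ring
      _ ≤ _ := hB.trans h1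
      _ = 2 * (m * m) * (R + 1) * N := by ring
  have hmain' : (N : ℝ) * (m * m) ≤ N * d + m * C + m * m * B := by exact_mod_cast hmain
  have hBle' : (B : ℝ) * 8 ≤ N := by exact_mod_cast hBle
  have h1 : (m : ℝ) * (C * 4) ≤ m * (N * m) := by gcongr
  have h2 : (m : ℝ) * m * (B * 8) ≤ m * m * N := by gcongr
  have hN0 : (0 : ℝ) < N := by exact_mod_cast hNpos
  have h3 : (N : ℝ) * m ^ 2 ≤ N * (2 * d) := by nlinarith [mul_pos hN0 hN0, sq_nonneg (m : ℝ)]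
  have h4 := le_of_mul_le_mul_left h3 hN0
  linarith

end Fragility

/-- If all (finite) planar graphs of treewidth at most two are fractionally treedepth-fragile at
rate `r`, then `r a = Ω(a ^ 2)`. -/
theorem mainTheorem4 (r : ℕ → ℝ≥0) (hr : Monotone r)
    (hfrag : ∀ (V : Type) [Finite V] (G : SimpleGraph V), Fragility.IsPlanar G →
      Fragility.treewidth G ≤ 2 → Fragility.FractionallyFragile Fragility.td r G) :
    (fun a : ℕ => (a : ℝ) ^ 2) =O[Filter.atTop] (fun a : ℕ => (r a : ℝ)) := by
  refine Asymptotics.IsBigO.of_bound 2048 ?_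
  filter_upwards [Filter.eventually_ge_atTop 16] with a ha
  have h := Fragility.sq_le_two_mul_of_fragile r hfrag (a := a) (m := a / 16)
    (Nat.div_pos ha (by norm_num)) (Nat.mul_div_le a 16)
  have ha' : (a : ℝ) ≤ 32 * (a / 16 : ℕ) := by
    have : a ≤ 32 * (a / 16) := by omega
    exact_mod_cast this
  rw [Real.norm_of_nonneg (by positivity), Real.norm_of_nonneg (NNReal.coe_nonneg _)]
  have h1 : (a : ℝ) ^ 2 ≤ (32 * (a / 16 : ℕ)) ^ 2 := by gcongr
  nlinarith
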